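/- For integers $n\ge k\ge 1$ and $S\subseteq\{0,1,\dots,k-1\}$, the generalized Johnson graph $J_S(n,k)$ has as vertices the $k$-subsets of $[n]=\{1,\dots,n\}$; two distinct vertices are adjacent if the size of their intersection lies in $S$. A set $B$ of vertices of a finite graph $G$ is a zero forcing set if, starting with exactly the vertices of $B$ coloured black and all others white, all vertices can be made black by repeatedly applying the rule: if $w$ is the unique white neighbour of a black vertex, then $w$ becomes black. The zero forcing number $Z(G)$, the total zero forcing number $Z_t(G)$ and the connected zero forcing number $Z_c(G)$ are the smallest cardinalities of, respectively, a zero forcing set $B$, a zero forcing set $B$ such that the induced subgraph $G[B]$ has no isolated vertices, and a zero forcing set $B$ such that $G[B]$ is connected. **Theorem.** Let $S\subseteq\{0,1,\dots,k-2\}$ be non-empty, let $t=\max(S)$, and let $n\ge\max(3k-2t+1,\,2k+1)$. Then \[ Z(J_S(n,k))\le Z_t(J_S(n,k))\le Z_c(J_S(n,k))\le\binom nk-\binom{2k-2t}{k-t}. \] More precisely, let $T=\{n-2k+2t+2,\dots,n\}$ and \[ \mathcal W_1=\{v : |v\cap T|=k-t,\ [t]\subseteq v\},\qquad \mathcal W_2=\{v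 : [t+1]\subseteq v\subseteq[2k-t]\}, \] where $v$ ranges over the $k$-subsets of $[n]$. Then the set of all vertices of $J_S(n,k)$ outside $\mathcal W_1\cup\mathcal W_2$ is a zero forcing set of $J_S(n,k)$ that induces a connected subgraph, and it has exactly $\binom nk-\binom{2k-2t}{k-t}$ elements. If moreover $S=\{0,1,\dots,t\}$, then \[ Z(J_S(n,k))=Z_t(J_S(n,k))=Z_c(J_S(n,k))=\binom nk-\binom{2k-2t}{k-t}. \] -/

import Mathlib

/-- Vertices of the generalized Johnson graphs: the `k`-subsets of `[n] = {1, …, n}`. -/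
abbrev KSubset (n k : ℕ) : Type := ↥((Finset.Icc 1 n).powersetCard k)

/-- The generalized Johnson graph `J_S(n,k)`: two distinct `k`-subsets of `{1, …, n}` are
adjacent when the size of their intersection lies in `S`. -/
def genJohnson (S : Finset ℕ) (n k : ℕ) : SimpleGraph (KSubset n k) where
  Adj v w := v ≠ w ∧ ((v : Finset ℕ) ∩ (w : Finset ℕ)).card ∈ S
  symm := ⟨fun v w h => ⟨h.1.symm, by rw [Finset.inter_comm]; exact h.2⟩⟩
  loopless := ⟨fun _ h => h.1 rfl⟩

/-- One colour change: `B` is the set of black vertices before it, `B'` the one after it. A black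
vertex `v` colours `w` black, where `w` is the unique white neighbour of `v`. -/
def ForceStep {V : Type*} (G : SimpleGraph V) (B B' : Set V) : Prop :=
  ∃ v ∈ B, ∃ w ∉ B, G.Adj v w ∧ (∀ u, G.Adj v u → u ∉ B → u = w) ∧ B' = insert w B

/-- `B` is a zero forcing set of the finite graph `G`: starting with exactly the vertices of `B`
black, some sequence of colour changes makes all vertices black. -/
def IsZeroForcingSet {V : Type*} (G : SimpleGraph V) (B : Set V) : Prop :=
  Relation.ReflTransGen (ForceStep G) B Set.univ

/-- A zero forcing set `B` such that the induced subgraph `G[B]` has no isolated vertices. -/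
def IsTotalZeroForcingSet {V : Type*} (G : SimpleGraph V) (B : Set V) : Prop :=
  IsZeroForcingSet G B ∧ ∀ v : B, ∃ w : B, (G.induce B).Adj v w

/-- A zero forcing set `B` such that the induced subgraph `G[B]` is connected. -/
def IsConnectedZeroForcingSet {V : Type*} (G : SimpleGraph V) (B : Set V) : Prop :=
  IsZeroForcingSet G B ∧ (G.induce B).Connected

/-- The zero forcing number `Z(G)` of a finite graph. -/
noncomputable def zeroForcingNumber {V : Type*} (G : SimpleGraph V) : ℕ∞ :=
  ⨅ (B : Set V) (_ : IsZeroForcingSet G B), B.encard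

/-- The total zero forcing number `Z_t(G)` of a finite graph (`⊤` if there is no total zero
forcing set). -/
noncomputable def totalZeroForcingNumber {V : Type*} (G : SimpleGraph V) : ℕ∞ :=
  ⨅ (B : Set V) (_ : IsTotalZeroForcingSet G B), B.encard

/-- The connected zero forcing number `Z_c(G)` of a finite graph (`⊤` if there is no connected
zero forcing set). -/
noncomputable def connectedZeroForcingNumber {V : Type*} (G : SimpleGraph V) : ℕ∞ :=
  ⨅ (B : Set V) (_ : IsConnectedZeroForcingSet G B), B.encard

/-- The `k`-subsets `v` of `{1, …, n}` with `{1, …, t} ⊆ v` and `|v ∩ T| = k - t`, where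
`T = {n - 2k + 2t + 2, …, n}`. -/
def whiteSet₁ (n k t : ℕ) : Set (KSubset n k) :=
  {v | ((v : Finset ℕ) ∩ Finset.Icc (n - 2 * k + 2 * t + 2) n).card = k - t ∧
    Finset.Icc 1 t ⊆ (v : Finset ℕ)}

/-- The `k`-subsets `v` of `{1, …, n}` with `{1, …, t + 1} ⊆ v ⊆ {1, …, 2k - t}`. -/
def whiteSet₂ (n k t : ℕ) : Set (KSubset n k) :=
  {v | (v : Finset ℕ) ⊆ Finset.Icc 1 (2 * k - t) ∧ Finset.Icc 1 (t + 1) ⊆ (v : Finset ℕ)}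

/-- The explicit leader set: all vertices outside the two families above. -/
def leaderSet (n k t : ℕ) : Set (KSubset n k) := (whiteSet₁ n k t ∪ whiteSet₂ n k t)ᶜ

/-!
The set outside the two families has the right size because each family consists of all sets made
of a fixed part and of arbitrarily chosen points of a set with `2(k - t) - 1` elements, so that
Pascal's rule adds up the two binomial coefficients.

It is a zero forcing set: a vertex `w` of the first family meets `[t + 1] ∪ (T \ w)` in exactly `[t]`,
while every other white vertex meets this set in more than `t` points; the bound on `n` makes it
black, since `T \ w` does not fit into `[2k - t]`. Once the first family is black, a vertex `w` of the
second family is forced in the same way by `[t] ∪ ({t + 2, …, 2k - t} \ w)`. Intersection sizes above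
`t = max S` never give adjacency, so only the intersections of size `t` matter
(`isZeroForcingSet_leaderSet`).

It is connected: all vertices containing `t + 1` and `n` are black, and two vertices that differ in
at most two points, one of them of this kind, have a black common neighbour
(`exists_common_leader_neighbor`). Exchanging at most two points at a time, every black vertex is
thus joined to a fixed one.

For `S = {0, …, t}` the forcing vertices `v i` and the forced vertices `w i` of any zero forcing
process satisfy `|v i ∩ w i| ≤ t` and `|v i ∩ w j| > t` for `i < j`. Füredi's skew version of the
Bollobás inequality (`card_le_choose_of_skew_set_pairs`) then bounds the number of steps by
`(2k - 2t).choose (k - t)`. For its proof each point `e` gets a generic vector `(x, y)` with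
`x ∈ ℚ^(p+q)` and `y ∈ ℚ^t`, and a pair of sets `A`, `B` of sizes `p + t` and `q + t` gets the
determinant with the rows `(x, y, 0)` for the points of `A` and `(x, 0, y)` for those of `B`. If `A`
and `B` share more than `t` points, a linear relation between the vectors `y` of the common points
makes it vanish; if they share at most `t`, some choice of vectors gives the identity matrix, so that
it is not zero for generic vectors. For fixed `B` it is an alternating form in the vectors of `A`
which vanishes on tuples of basis vectors missing one of the last `t` coordinates. Such forms span a
space of dimension at most `(p + q).choose p`, and the skew condition makes the forms of the sets
`B i` linearly independent.
-/

/-! ### Set pairs with bounded intersections -/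

/-- The coordinates of the vectors attached to the points of the ground set: the first `p + q` of
them serve both families, the last `t` ones are used separately by each family. -/
abbrev PairCoord (p q t : ℕ) : Type := (Fin p ⊕ Fin q) ⊕ Fin t

/-- The common index set of the rows and columns of the matrix attached to a pair of sets of sizes
`p + t` and `q + t`. As row indices its two parts enumerate the two sets. As column indices the two
copies of `Fin t` are the separate blocks into which the last `t` coordinates are put, and `Fin p`
and `Fin q` together are the `p + q` shared coordinates. -/
abbrev PairIndex (p q t : ℕ) : Type := (Fin p ⊕ Fin t) ⊕ (Fin q ⊕ Fin t)

/-- The row of length `p + q + 2t` belonging to a point of the first set: the last `t` coordinates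
are put into the first of the two blocks of length `t`, the second block is zero. -/
def leftRow {R : Type*} [CommRing R] (p q t : ℕ) :
    (PairCoord p q t → R) →ₗ[R] (PairIndex p q t → R) :=
  LinearMap.pi fun c => match c with
    | .inl (.inl i) => LinearMap.proj (.inl (.inl i))
    | .inl (.inr s) => LinearMap.proj (.inr s)
    | .inr (.inl j) => LinearMap.proj (.inl (.inr j))
    | .inr (.inr _) => 0

/-- The row of length `p + q + 2t` belonging to a point of the second set: the last `t` coordinates
are put into the second of the two blocks of length `t`, the first block is zero. -/
def rightRow {R : Type*} [CommRing R] (p q t : ℕ) :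
    (PairCoord p q t → R) →ₗ[R] (PairIndex p q t → R) :=
  LinearMap.pi fun c => match c with
    | .inl (.inl i) => LinearMap.proj (.inl (.inl i))
    | .inl (.inr _) => 0
    | .inr (.inl j) => LinearMap.proj (.inl (.inr j))
    | .inr (.inr s) => LinearMap.proj (.inr s)

/-- The square matrix whose rows are the `leftRow`s of the vectors `u` and the `rightRow`s of the
vectors `w`. -/
def pairMatrix {R : Type*} [CommRing R] {p q t : ℕ} (u : Fin p ⊕ Fin t → PairCoord p q t → R)
    (w : Fin q ⊕ Fin t → PairCoord p q t → R) : Matrix (PairIndex p q t) (PairIndex p q t) R :=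
  Matrix.of (Sum.elim (fun i => leftRow p q t (u i)) (fun j => rightRow p q t (w j)))

lemma pairMatrix_update {R : Type*} [CommRing R] {p q t : ℕ}
    (u : Fin p ⊕ Fin t → PairCoord p q t → R) (w : Fin q ⊕ Fin t → PairCoord p q t → R)
    (i : Fin p ⊕ Fin t) (z : PairCoord p q t → R) :
    pairMatrix (Function.update u i z) w =
      (pairMatrix u w).updateRow (.inl i) (leftRow p q t z) := by
  ext (a | a) c
  · by_cases h : a = i
    · subst h
      simp [pairMatrix]
    · simp [pairMatrix, Matrix.updateRow_apply, h]
  · simp [pairMatrix, Matrix.updateRow_apply]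

/-- The determinant of `pairMatrix u w` as an alternating form in `u`. -/
def pairForm {R : Type*} [CommRing R] {p q t : ℕ} (w : Fin q ⊕ Fin t → PairCoord p q t → R) :
    (PairCoord p q t → R) [⋀^Fin p ⊕ Fin t]→ₗ[R] R where
  toFun u := (pairMatrix u w).det
  map_update_add' {inst} u i x y := by
    rw [Subsingleton.elim inst instDecidableEqSum]
    simp only [pairMatrix_update, map_add, Matrix.det_updateRow_add]
  map_update_smul' {inst} u i c x := by
    rw [Subsingleton.elim inst instDecidableEqSum]
    simp only [pairMatrix_update, map_smul, Matrix.det_updateRow_smul, smul_eq_mul]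
  map_eq_zero_of_eq' u i j hij hne :=
    Matrix.det_zero_of_row_eq (i := .inl i) (j := .inl j) (by simpa using hne)
      (by ext c; simp [pairMatrix, hij])

lemma pairForm_apply {R : Type*} [CommRing R] {p q t : ℕ}
    (w : Fin q ⊕ Fin t → PairCoord p q t → R) (u : Fin p ⊕ Fin t → PairCoord p q t → R) :
    pairForm w u = (pairMatrix u w).det := rfl

/-- If no vector of `u` involves one of the last `t` coordinates, then the corresponding column of
the matrix vanishes. -/
lemma pairForm_eq_zero_of_coord {R : Type*} [CommRing R] {p q t : ℕ}
    (w : Fin q ⊕ Fin t → PairCoord p q t → R) (u : Fin p ⊕ Fin t → PairCoord p q t → R)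
    (s : Fin t) (h : ∀ i, u i (.inr s) = 0) : pairForm w u = 0 := by
  rw [pairForm_apply]
  refine Matrix.det_eq_zero_of_column_eq_zero (.inl (.inr s)) ?_
  rintro (a | a)
  · simpa [pairMatrix, leftRow] using h a
  · simp [pairMatrix, rightRow]

/-- The forms in question are determined by their values on the tuples of basis vectors that use
each of the last `t` coordinates, hence live in a space of dimension at most `(p + q).choose p`. -/
lemma card_le_choose_of_linearIndependent_forms {K : Type*} [Field K] {p q t r : ℕ}
    (f : Fin r → (PairCoord p q t → K) [⋀^Fin p ⊕ Fin t]→ₗ[K] K) (hf : LinearIndependent K f)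
    (h : ∀ i, ∀ u : Fin p ⊕ Fin t → PairCoord p q t → K, ∀ s : Fin t,
      (∀ a, u a (.inr s) = 0) → f i u = 0) : r ≤ (p + q).choose p := by
  classical
  let P := ↥((Finset.univ : Finset (Fin p ⊕ Fin q)).powersetCard p)
  have hc (s : P) : s.1.card = p := (Finset.mem_powersetCard.1 s.2).2
  let τ (s : P) : Fin p ⊕ Fin t → PairCoord p q t :=
    Sum.map (fun i => ((s.1.equivFinOfCardEq (hc s)).symm i : Fin p ⊕ Fin q)) id
  let L : ((PairCoord p q t → K) [⋀^Fin p ⊕ Fin t]→ₗ[K] K) →ₗ[K] (P → K) :=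
    { toFun := fun g s => g fun i => Pi.basisFun K _ (τ s i)
      map_add' := fun _ _ => rfl
      map_smul' := fun _ _ => rfl }
  let U : Submodule K ((PairCoord p q t → K) [⋀^Fin p ⊕ Fin t]→ₗ[K] K) :=
    { carrier := {g | ∀ u : Fin p ⊕ Fin t → PairCoord p q t → K, ∀ s : Fin t,
        (∀ a, u a (.inr s) = 0) → g u = 0}
      add_mem' := fun {a b} ha hb u s hu => by simp [ha u s hu, hb u s hu]
      zero_mem' := fun u s _ => by simp
      smul_mem' := fun c a ha u s hu => by simp [ha u s hu] }
  have hker : ∀ g ∈ U, L g = 0 → g = 0 := by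
    intro g hg hLg
    refine Module.Basis.ext_alternating (Pi.basisFun K _) fun v hv => ?_
    rw [AlternatingMap.zero_apply]
    by_cases hall : ∀ s : Fin t, ∃ a, v a = .inr s
    · let s₀ : Finset (Fin p ⊕ Fin q) := Finset.univ.filter fun c => ∃ a, v a = .inl c
      have him : Finset.univ.image v = s₀.disjSum Finset.univ := by
        ext (c | c) <;> simp [s₀, hall]
      have hcard : s₀.card = p := by
        have := congrArg Finset.card him
        rw [Finset.card_image_of_injective _ hv, Finset.card_disjSum] at this
        simpa using this.symm
      let s : P := ⟨s₀, Finset.mem_powersetCard.2 ⟨Finset.subset_univ _, hcard⟩⟩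
      have hmem : ∀ a, ∃ b, τ s b = v a := by
        intro a
        rcases hva : v a with c | c
        · have hcs : c ∈ s.1 := by simp only [s, s₀, Finset.mem_filter_univ]; exact ⟨a, hva⟩
          exact ⟨.inl (s.1.equivFinOfCardEq (hc s) ⟨c, hcs⟩), by simp [τ]⟩
        · exact ⟨.inr c, rfl⟩
      choose σ hσ using hmem
      have hσi : Function.Injective σ := fun a b hab => hv (by rw [← hσ, ← hσ, hab])
      let e := Equiv.ofBijective σ (Finite.injective_iff_bijective.1 hσi)
      have h1 : (fun i => Pi.basisFun K (PairCoord p q t) (v i)) =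
          (fun i => Pi.basisFun K _ (τ s i)) ∘ e := by
        funext i
        simp only [Function.comp, e, Equiv.ofBijective_apply, hσ]
      rw [h1, AlternatingMap.map_perm, show (g fun i => Pi.basisFun K _ (τ s i)) = 0 from
        congrFun hLg s, smul_zero]
    · push Not at hall
      obtain ⟨s, hs⟩ := hall
      refine hg _ s fun a => ?_
      rw [Pi.basisFun_apply, Pi.single_eq_of_ne (hs a).symm]
  have hspan : Submodule.span K (Set.range f) ≤ U := by
    rw [Submodule.span_le]
    rintro _ ⟨i, rfl⟩
    exact h i
  have hLf : LinearIndependent K (L ∘ f) := hf.map <| by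
    rw [Submodule.disjoint_def]
    exact fun g hg hk => hker g (hspan hg) hk
  have := hLf.fintype_card_le_finrank
  simpa [P] using this

/-- A pair of sets with more than `t` common points gives a singular matrix: a non-trivial relation
between the last `t` coordinates of the common points yields one between the rows. -/
lemma pairForm_eq_zero_of_lt_card_inter {α K : Type*} [DecidableEq α] [Field K] {p q t : ℕ}
    (x : α → PairCoord p q t → K) {A B : Finset α} (a : Fin p ⊕ Fin t ≃ A) (b : Fin q ⊕ Fin t ≃ B)
    (h : t < (A ∩ B).card) :
    pairForm (fun j => x (b j)) (fun i => x (a i)) = 0 := by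
  have hdep : ¬ LinearIndependent K fun (e : ↥(A ∩ B)) (s : Fin t) => x e (.inr s) := by
    intro hli
    have := hli.fintype_card_le_finrank
    rw [Module.finrank_fin_fun, Fintype.card_coe] at this
    omega
  obtain ⟨d₀, hd₀, e₀, he₀⟩ := Fintype.not_linearIndependent_iff.1 hdep
  let d : α → K := fun e => if he : e ∈ A ∩ B then d₀ ⟨e, he⟩ else 0
  have hdz : ∀ e, e ∉ A ∩ B → d e = 0 := fun e he => dif_neg he
  have hd (s : Fin t) : ∑ e ∈ A ∩ B, d e * x e (.inr s) = 0 := by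
    rw [← Finset.sum_coe_sort]
    have := congrFun hd₀ s
    rw [Finset.sum_apply] at this
    rw [← Pi.zero_apply (M := fun _ : Fin t => K) s, ← this]
    exact Finset.sum_congr rfl fun e _ => by simp only [d, e.2, dif_pos]; rfl
  have hA (F : α → K) : ∑ i, d (a i) * F (a i) = ∑ e ∈ A ∩ B, d e * F e := by
    rw [Equiv.sum_comp a (fun e : A => d e * F e), Finset.sum_coe_sort A (fun e => d e * F e)]
    refine (Finset.sum_subset Finset.inter_subset_left fun e _ he => ?_).symm
    rw [hdz e he, zero_mul]
  have hB (F : α → K) : ∑ i, d (b i) * F (b i) = ∑ e ∈ A ∩ B, d e * F e := by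
    rw [Equiv.sum_comp b (fun e : B => d e * F e), Finset.sum_coe_sort B (fun e => d e * F e)]
    refine (Finset.sum_subset Finset.inter_subset_right fun e _ he => ?_).symm
    rw [hdz e he, zero_mul]
  rw [pairForm_apply]
  refine Matrix.exists_vecMul_eq_zero_iff.1
    ⟨Sum.elim (fun i => d (a i)) (fun j => -d (b j)), ?_, ?_⟩
  · intro hz
    apply he₀
    have := congrFun hz (.inl (a.symm ⟨e₀, (Finset.mem_inter.1 e₀.2).1⟩))
    have he := e₀.2
    simpa [d, he, -Finset.mem_inter] using this
  · ext ((c | c) | (c | c))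
    all_goals
      simp only [Matrix.vecMul, dotProduct, Fintype.sum_sum_type (α₁ := Fin p ⊕ Fin t), pairMatrix,
        Matrix.of_apply, Sum.elim_inl, Sum.elim_inr, leftRow, rightRow, LinearMap.pi_apply,
        LinearMap.proj_apply, LinearMap.zero_apply, neg_mul, mul_zero,
        Finset.sum_neg_distrib, Finset.sum_const_zero, add_zero, zero_add, Pi.zero_apply]
    · rw [hA fun e => x e (.inl (.inl c)), hB fun e => x e (.inl (.inl c)), add_neg_cancel]
    · exact (hA fun e => x e (.inr c)).trans (hd c)
    · rw [hA fun e => x e (.inl (.inr c)), hB fun e => x e (.inl (.inr c)), add_neg_cancel]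
    · rw [hB fun e => x e (.inr c), hd, neg_zero]

/-- Two sets with at most `t` common points can be enumerated so that every common point occurs at
the same place among the last `t` ones in both enumerations. Hence the points can be mapped to
vectors in such a way that each of the two sets is mapped to prescribed unit vectors. -/
lemma exists_enumerations {α : Type*} [DecidableEq α] {p q t : ℕ} {A B : Finset α}
    (hA : A.card = p + t) (hB : B.card = q + t) (h : (A ∩ B).card ≤ t) :
    ∃ (a : Fin p ⊕ Fin t ≃ A) (b : Fin q ⊕ Fin t ≃ B) (x : α → PairCoord p q t → ℚ),
      (∀ i, x (a i) = Pi.single (Sum.map Sum.inl id i) 1) ∧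
      ∀ j, x (b j) = Pi.single (Sum.map Sum.inr id j) 1 := by
  obtain ⟨A₀, hAB, hA₀, hcA₀⟩ := Finset.exists_subsuperset_card_eq
    (Finset.inter_subset_left : A ∩ B ⊆ A) h (by omega)
  let a₁ : Fin p ⊕ Fin t ≃ A := Fintype.equivOfCardEq (by simp [hA])
  let b₁ : Fin q ⊕ Fin t ≃ B := Fintype.equivOfCardEq (by simp [hB])
  let e : Fin t ≃ A₀ := (A₀.equivFinOfCardEq hcA₀).symm
  obtain ⟨a, ha⟩ := Finset.exists_equiv_extend_of_card_eq (α := Fin p ⊕ Fin t) (t := A)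
    (by simp [hA]) (s := Finset.univ.filter (fun i => i.isRight))
    (f := Sum.elim (fun i => (a₁ (.inl i) : α)) (fun s => (e s : α)))
    (by
      intro y hy
      simp only [Finset.mem_image, Finset.mem_filter_univ] at hy
      obtain ⟨i | s, hs, rfl⟩ := hy
      · simp at hs
      · exact hA₀ (e s).2)
    (by
      rintro (i | i) hi (j | j) hj hij
      all_goals simp_all)
  have ha' (s : Fin t) : (a (.inr s) : α) = e s := ha (.inr s) (by simp)
  obtain ⟨b, hb⟩ := Finset.exists_equiv_extend_of_card_eq (α := Fin q ⊕ Fin t) (t := B)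
    (by simp [hB])
    (s := Finset.univ.filter (fun i => ∃ s, i = .inr s ∧ (e s : α) ∈ B))
    (f := Sum.elim (fun i => (b₁ (.inl i) : α)) (fun s => (e s : α)))
    (by
      intro y hy
      simp only [Finset.mem_image, Finset.mem_filter_univ] at hy
      obtain ⟨_, ⟨s, rfl, hs⟩, rfl⟩ := hy
      exact hs)
    (by
      rintro i hi j hj hij
      simp only [Finset.coe_filter, Finset.mem_univ, true_and, Set.mem_ofPred_eq] at hi hj
      obtain ⟨s, rfl, -⟩ := hi
      obtain ⟨s', rfl, -⟩ := hj
      simpa using hij)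
  have hb' (s : Fin t) (hs : (e s : α) ∈ B) : (b (.inr s) : α) = e s :=
    hb (.inr s) (by simpa using hs)
  -- A common point has the same position in both enumerations.
  have hcommon (j : Fin q ⊕ Fin t) (hj : (b j : α) ∈ A) :
      ∃ s, j = .inr s ∧ a.symm ⟨b j, hj⟩ = .inr s := by
    have hm : (b j : α) ∈ A₀ := hAB (Finset.mem_inter.2 ⟨hj, (b j).2⟩)
    obtain ⟨s, hs⟩ := e.surjective ⟨_, hm⟩
    have hs' : (e s : α) = b j := congrArg Subtype.val hs
    refine ⟨s, ?_, ?_⟩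
    · apply b.injective
      apply Subtype.ext
      rw [hb' s (hs' ▸ (b j).2), hs']
    · rw [Equiv.symm_apply_eq]
      apply Subtype.ext
      rw [ha', hs']
  refine ⟨a, b, fun y => if hy : y ∈ A then Pi.single (Sum.map Sum.inl id (a.symm ⟨y, hy⟩)) 1 else
    if hy : y ∈ B then Pi.single (Sum.map Sum.inr id (b.symm ⟨y, hy⟩)) 1 else 0,
    fun i => by simp, fun j => ?_⟩
  by_cases hj : (b j : α) ∈ A
  · obtain ⟨s, rfl, hs⟩ := hcommon j hj
    simp only [hj, dif_pos, hs]
    rfl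
  · simp [hj]

lemma pairForm_single (p q t : ℕ) :
    pairForm (fun j : Fin q ⊕ Fin t => Pi.single (M := fun _ : PairCoord p q t => ℚ)
      (Sum.map Sum.inr id j) 1) (fun i => Pi.single (Sum.map Sum.inl id i) 1) = 1 := by
  rw [pairForm_apply]
  convert Matrix.det_one (R := ℚ) (n := PairIndex p q t)
  ext ((i | i) | (i | i)) ((j | j) | (j | j)) <;>
    simp [pairMatrix, leftRow, rightRow, Matrix.one_apply, Pi.single_apply, eq_comm]

lemma map_pairForm {R R' : Type*} [CommRing R] [CommRing R'] {p q t : ℕ} (φ : R →+* R')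
    (w : Fin q ⊕ Fin t → PairCoord p q t → R) (u : Fin p ⊕ Fin t → PairCoord p q t → R) :
    φ (pairForm w u) = pairForm (fun j => φ ∘ w j) (fun i => φ ∘ u i) := by
  rw [pairForm_apply, pairForm_apply, RingHom.map_det]
  congr 1
  ext ((i | i) | (i | i)) ((j | j) | (j | j)) <;> simp [pairMatrix, leftRow, rightRow]

/-- Vectors in general position with respect to finitely many pairs of sets: whenever each form can
be made non-zero by some choice of vectors, one choice makes all of them non-zero. -/
lemma exists_forall_pairForm_ne_zero {α ι : Type*} [Finite ι] {p q t : ℕ}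
    (a : ι → Fin p ⊕ Fin t → α) (b : ι → Fin q ⊕ Fin t → α)
    (h : ∀ i, ∃ x : α → PairCoord p q t → ℚ,
      pairForm (fun s => x (b i s)) (fun s => x (a i s)) ≠ 0) :
    ∃ x : α → PairCoord p q t → ℚ,
      ∀ i, pairForm (fun s => x (b i s)) (fun s => x (a i s)) ≠ 0 := by
  cases nonempty_fintype ι
  let X : α → PairCoord p q t → MvPolynomial (α × PairCoord p q t) ℚ :=
    fun e c => MvPolynomial.X (e, c)
  let F (i : ι) := pairForm (fun s => X (b i s)) (fun s => X (a i s))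
  have hF (y : α × PairCoord p q t → ℚ) (i : ι) : MvPolynomial.eval y (F i) =
      pairForm (fun s c => y (b i s, c)) (fun s c => y (a i s, c)) := by
    rw [map_pairForm]
    congr 1
    · congr 1
      funext s c
      simp [X]
    · funext s c
      simp [X]
  have hne : ∏ i, F i ≠ 0 := Finset.prod_ne_zero_iff.2 fun i _ h0 => by
    obtain ⟨x, hx⟩ := h i
    apply hx
    rw [← hF (fun z => x z.1 z.2) i, h0, map_zero]
  obtain ⟨y, hy⟩ : ∃ y, MvPolynomial.eval y (∏ i, F i) ≠ 0 := by
    by_contra! h0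
    exact hne (MvPolynomial.funext fun y => by rw [h0, map_zero])
  rw [map_prod, Finset.prod_ne_zero_iff] at hy
  exact ⟨fun e c => y (e, c), fun i => by rw [← hF]; exact hy i (Finset.mem_univ i)⟩

/-- Füredi's skew version of the Bollobás set pairs inequality. -/
theorem card_le_choose_of_skew_set_pairs {α : Type*} [DecidableEq α] {p q t r : ℕ}
    (A B : Fin r → Finset α) (hA : ∀ i, (A i).card = p + t) (hB : ∀ i, (B i).card = q + t)
    (hdiag : ∀ i, (A i ∩ B i).card ≤ t) (hskew : ∀ i j, i < j → t < (A i ∩ B j).card) :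
    r ≤ (p + q).choose p := by
  choose a b x₀ ha hb using fun i => exists_enumerations (hA i) (hB i) (hdiag i)
  obtain ⟨x, hx⟩ := exists_forall_pairForm_ne_zero (fun i s => (a i s : α)) (fun i s => (b i s : α))
    fun i => ⟨x₀ i, by simp only [ha, hb, pairForm_single]; exact one_ne_zero⟩
  let f (j : Fin r) : (PairCoord p q t → ℚ) [⋀^Fin p ⊕ Fin t]→ₗ[ℚ] ℚ := pairForm fun s => x (b j s)
  refine card_le_choose_of_linearIndependent_forms f ?_
    fun i u s hs => pairForm_eq_zero_of_coord _ u s hs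
  -- The matrix of the values of the forms at the tuples `x ∘ a i` is triangular.
  let M : Matrix (Fin r) (Fin r) ℚ := Matrix.of fun j i => f j fun s => x (a i s)
  have hM : M.det ≠ 0 := by
    rw [Matrix.det_of_isUpperTriangular, Finset.prod_ne_zero_iff]
    · exact fun i _ => hx i
    · intro j i hij
      exact pairForm_eq_zero_of_lt_card_inter x (a i) (b j) (hskew i j hij)
  exact LinearIndependent.of_comp
    ({ toFun := fun g i => g fun s => x (a i s)
       map_add' := fun _ _ => rfl
       map_smul' := fun _ _ => rfl } :
      ((PairCoord p q t → ℚ) [⋀^Fin p ⊕ Fin t]→ₗ[ℚ] ℚ) →ₗ[ℚ] (Fin r → ℚ))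
    (Matrix.linearIndependent_rows_of_det_ne_zero hM)

/-! ### Zero forcing -/

/-- A zero forcing set comes with the sequence of its colour changes: `v i` forces `w i`, and at
that time the vertices `w j` with `i < j` are white, so that none of them equals the black vertex
`v i` or is adjacent to it. -/
lemma IsZeroForcingSet.exists_forcing_sequence {V : Type*} {G : SimpleGraph V} {B : Set V}
    (h : IsZeroForcingSet G B) :
    ∃ (r : ℕ) (v w : Fin r → V), Function.Injective w ∧ Set.range w = Bᶜ ∧
      (∀ i, G.Adj (v i) (w i)) ∧ ∀ i j, i < j → v i ≠ w j ∧ ¬ G.Adj (v i) (w j) := by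
  induction h using Relation.ReflTransGen.head_induction_on with
  | refl => exact ⟨0, Fin.elim0, Fin.elim0, fun i => i.elim0, by simp, fun i => i.elim0,
      fun i => i.elim0⟩
  | @head B _ hstep _ ih =>
    obtain ⟨v₀, hv₀, w₀, hw₀, hadj, huniq, rfl⟩ := hstep
    obtain ⟨r, v, w, hinj, hrange, hforce, hlater⟩ := ih
    have hw (j : Fin r) : w j ≠ w₀ ∧ w j ∉ B := by
      have : w j ∈ Set.range w := ⟨j, rfl⟩
      rw [hrange] at this
      simpa using this
    refine ⟨r + 1, Fin.cons v₀ v, Fin.cons w₀ w, ?_, ?_, ?_, ?_⟩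
    · rw [Fin.cons_injective_iff]
      exact ⟨fun ⟨j, hj⟩ => (hw j).1 hj, hinj⟩
    · rw [Fin.range_cons, hrange]
      ext x
      by_cases hx : x = w₀
      · simp [hx, hw₀]
      · simp [hx]
    · intro i
      cases i using Fin.cases with
      | zero => simpa using hadj
      | succ i => simpa using hforce i
    · intro i j hij
      cases j using Fin.cases with
      | zero => exact absurd hij (by simp)
      | succ j =>
        cases i using Fin.cases with
        | zero =>
          simp only [Fin.cons_zero, Fin.cons_succ]
          exact ⟨fun h => (hw j).2 (h ▸ hv₀), fun h => (hw j).1 (huniq _ h (hw j).2)⟩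
        | succ i => simpa using hlater i j (by simpa using hij)

/-- White vertices each of which is the only white neighbour of some black vertex can all be forced,
in any order. -/
lemma reflTransGen_forceStep_union {V : Type*} {G : SimpleGraph V} {B C : Set V} (hC : C.Finite)
    (h : ∀ w ∈ C, ∃ v ∈ B, G.Adj v w ∧ ∀ u, G.Adj v u → u ∉ B → u = w) :
    Relation.ReflTransGen (ForceStep G) B (B ∪ C) := by
  induction C, hC using Set.Finite.induction_on with
  | empty => rw [Set.union_empty]
  | @insert w C _ _ ih =>
    refine (ih fun w' hw' => h w' (Set.mem_insert_of_mem _ hw')).trans ?_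
    rw [Set.union_insert]
    by_cases hw : w ∈ B ∪ C
    · rw [Set.insert_eq_of_mem hw]
    · obtain ⟨v, hv, hadj, huniq⟩ := h w (Set.mem_insert _ _)
      exact .single ⟨v, .inl hv, w, hw, hadj, fun u hu hu' => huniq u hu fun h => hu' (.inl h), rfl⟩

/-- A connected zero forcing set is total unless it is a single vertex, which forces nothing in a
graph where every vertex has at least two neighbours. -/
lemma IsConnectedZeroForcingSet.isTotalZeroForcingSet {V : Type*} {G : SimpleGraph V} {B : Set V}
    (hG : ∀ v, ∃ u u', u ≠ u' ∧ G.Adj v u ∧ G.Adj v u') (h : IsConnectedZeroForcingSet G B) :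
    IsTotalZeroForcingSet G B := by
  refine ⟨h.1, fun v => ?_⟩
  rcases subsingleton_or_nontrivial B with hB | hB
  · have hBv : B = {v.1} := by
      ext x
      exact ⟨fun hx => congrArg Subtype.val (Subsingleton.elim (⟨x, hx⟩ : B) v),
        fun hx => (Set.mem_singleton_iff.1 hx) ▸ v.2⟩
    obtain ⟨u, u', huu', hu, hu'⟩ := hG v
    have hnot (x) (hx : G.Adj v x) : x ∉ B := by
      rw [hBv]
      exact fun h => G.ne_of_adj hx h.symm
    rcases Relation.ReflTransGen.cases_head h.1 with huniv | ⟨_, ⟨x, hx, w, _, _, huniq, _⟩, _⟩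
    · exact absurd (huniv ▸ Set.mem_univ u) (hnot u hu)
    · obtain rfl : x = v := by rw [hBv] at hx; exact hx
      exact absurd ((huniq u hu (hnot u hu)).trans (huniq u' hu' (hnot u' hu')).symm) huu'
  · exact h.2.preconnected.exists_adj_of_nontrivial v

lemma zeroForcingNumber_le_totalZeroForcingNumber {V : Type*} (G : SimpleGraph V) :
    zeroForcingNumber G ≤ totalZeroForcingNumber G :=
  le_iInf₂ fun B hB => iInf₂_le B hB.1

lemma totalZeroForcingNumber_le_connectedZeroForcingNumber {V : Type*} {G : SimpleGraph V}
    (hG : ∀ v, ∃ u u', u ≠ u' ∧ G.Adj v u ∧ G.Adj v u') :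
    totalZeroForcingNumber G ≤ connectedZeroForcingNumber G :=
  le_iInf₂ fun B hB => iInf₂_le B (hB.isTotalZeroForcingSet hG)

/-- In `J_S(n,k)` with `S = {0, …, t}`, a forcing vertex meets the forced one in at most `t` points
and every vertex forced later in more than `t` points, so that the set pairs inequality bounds the
number of colour changes. -/
lemma choose_le_ncard_add_of_isZeroForcingSet {n k t : ℕ} (htk : t ≤ k) {B : Set (KSubset n k)}
    (hB : IsZeroForcingSet (genJohnson (Finset.range (t + 1)) n k) B) :
    n.choose k ≤ B.ncard + (2 * k - 2 * t).choose (k - t) := by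
  obtain ⟨r, v, w, hinj, hrange, hforce, hlater⟩ := hB.exists_forcing_sequence
  have hcard (u : KSubset n k) : (u : Finset ℕ).card = k - t + t := by
    rw [Nat.sub_add_cancel htk]
    exact (Finset.mem_powersetCard.1 u.2).2
  have hr : r ≤ (k - t + (k - t)).choose (k - t) :=
    card_le_choose_of_skew_set_pairs (fun i => (v i : Finset ℕ)) (fun i => (w i : Finset ℕ))
      (fun i => hcard _) (fun i => hcard _)
      (fun i => Nat.lt_succ_iff.1 (Finset.mem_range.1 (hforce i).2))
      (fun i j hij => by
        by_contra hle
        exact (hlater i j hij).2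
          ⟨(hlater i j hij).1, Finset.mem_range.2 (Nat.lt_succ_iff.2 (not_lt.1 hle))⟩)
  have hc : Bᶜ.ncard = r := by
    rw [← hrange, Set.ncard_range_of_injective hinj, Nat.card_fin]
  have htot := Set.ncard_add_ncard_compl B
  rw [hc, Nat.card_eq_fintype_card, Fintype.card_coe, Finset.card_powersetCard, Nat.card_Icc,
    Nat.add_sub_cancel] at htot
  rw [show 2 * k - 2 * t = k - t + (k - t) by omega]
  omega

/-! ### Adjacency in generalized Johnson graphs -/

lemma KSubset.subset_Icc {n k : ℕ} (v : KSubset n k) : (v : Finset ℕ) ⊆ Finset.Icc 1 n :=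
  (Finset.mem_powersetCard.1 v.2).1

lemma KSubset.card_eq {n k : ℕ} (v : KSubset n k) : (v : Finset ℕ).card = k :=
  (Finset.mem_powersetCard.1 v.2).2

/-- A neighbour of `v` is made of `t` points of `v` and `k - t` points outside `v`. -/
lemma exists_genJohnson_vertex {n k t : ℕ} {S : Finset ℕ} (htS : t ∈ S) (htk : t < k)
    {P Q : Finset ℕ} (hP : P ⊆ Finset.Icc 1 n) (hQ : Q ⊆ Finset.Icc 1 n) (hPQ : Disjoint P Q)
    (hcP : P.card = t) (hcQ : Q.card = k - t) :
    ∃ u : KSubset n k, (u : Finset ℕ) = P ∪ Q ∧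
      ∀ v : KSubset n k, P ⊆ (v : Finset ℕ) → Disjoint (v : Finset ℕ) Q →
        (genJohnson S n k).Adj v u := by
  have hc : (P ∪ Q).card = k := by
    rw [Finset.card_union_of_disjoint hPQ]
    omega
  refine ⟨⟨P ∪ Q, Finset.mem_powersetCard.2 ⟨Finset.union_subset hP hQ, hc⟩⟩, rfl,
    fun v hv hvQ => ?_⟩
  have hinter : (v : Finset ℕ) ∩ (P ∪ Q) = P := by
    rw [Finset.inter_union_distrib_left, Finset.inter_eq_right.2 hv,
      Finset.disjoint_iff_inter_eq_empty.1 hvQ, Finset.union_empty]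
  refine ⟨fun hvu => ?_, by simpa [hinter, hcP] using htS⟩
  have : (v : Finset ℕ) = P ∪ Q := congrArg Subtype.val hvu
  rw [← this, Finset.inter_self] at hinter
  have := v.card_eq
  rw [hinter] at this
  omega

lemma exists_two_neighbors {n k t : ℕ} {S : Finset ℕ} (htS : t ∈ S) (htk : t < k)
    (hn : 2 * k < n + t) (v : KSubset n k) :
    ∃ u u', u ≠ u' ∧ (genJohnson S n k).Adj v u ∧ (genJohnson S n k).Adj v u' := by
  obtain ⟨P, hPv, hcP⟩ := Finset.exists_subset_card_eq (s := (v : Finset ℕ)) (n := t)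
    (by rw [v.card_eq]; omega)
  have hO : (Finset.Icc 1 n \ (v : Finset ℕ)).card = n - k := by
    rw [Finset.card_sdiff_of_subset v.subset_Icc, v.card_eq, Nat.card_Icc, Nat.add_sub_cancel]
  obtain ⟨Q, hQ, hcQ⟩ := Finset.exists_subset_card_eq
    (s := Finset.Icc 1 n \ (v : Finset ℕ)) (n := k - t + 1) (by omega)
  obtain ⟨x, hx, y, hy, hxy⟩ := Finset.one_lt_card.1 (show 1 < Q.card by omega)
  have hQv : Disjoint (v : Finset ℕ) Q := Finset.disjoint_of_subset_right hQ Finset.disjoint_sdiff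
  have key (z) (hz : z ∈ Q) : ∃ u : KSubset n k, (u : Finset ℕ) = P ∪ Q.erase z ∧
      (genJohnson S n k).Adj v u := by
    obtain ⟨u, hu, hadj⟩ := exists_genJohnson_vertex (n := n) htS htk (P := P) (Q := Q.erase z)
      (hPv.trans v.subset_Icc)
      ((Finset.erase_subset _ _).trans (hQ.trans Finset.sdiff_subset))
      (Finset.disjoint_of_subset_left hPv
        (Finset.disjoint_of_subset_right (Finset.erase_subset _ _) hQv))
      hcP (by rw [Finset.card_erase_of_mem hz, hcQ, Nat.add_sub_cancel])
    exact ⟨u, hu, hadj v hPv (Finset.disjoint_of_subset_right (Finset.erase_subset _ _) hQv)⟩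
  obtain ⟨u, hu, hvu⟩ := key x hx
  obtain ⟨u', hu', hvu'⟩ := key y hy
  refine ⟨u, u', fun h => ?_, hvu, hvu'⟩
  have hxu : x ∈ (u' : Finset ℕ) := by
    rw [hu']
    exact Finset.mem_union_right _ (Finset.mem_erase.2 ⟨hxy, hx⟩)
  rw [← h, hu] at hxu
  rcases Finset.mem_union.1 hxu with h | h
  · exact Finset.disjoint_left.1 hQv (hPv h) hx
  · exact (Finset.mem_erase.1 h).1 rfl

/-! ### The two families of white vertices -/

/-- A set which contains `F` and meets a set `I` disjoint from `F` in exactly the missing number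
of points consists of these points. -/
lemma eq_union_inter_of_card {v F I : Finset ℕ} (hFI : Disjoint F I) (hF : F ⊆ v)
    (hc : v.card = F.card + (v ∩ I).card) : v = F ∪ (v ∩ I) := by
  refine (Finset.eq_of_subset_of_card_le (Finset.union_subset hF Finset.inter_subset_left) ?_).symm
  rw [Finset.card_union_of_disjoint (Finset.disjoint_of_subset_right Finset.inter_subset_right hFI)]
  exact hc.le

/-- Let `u` and `w` consist of `F` and `a` points of `I` each, let `u` and `v` share a set `E` of `t`
points outside `I`, and let `v` contain the points of `I` outside `w`. If `u` and `v` have no common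
points besides `E`, then `u` has no point of `I` outside `w`, hence equals `w`. -/
lemma eq_of_card_inter_le {u w v E F I : Finset ℕ} {a t : ℕ} (hFI : Disjoint F I) (hFu : F ⊆ u)
    (hFw : F ⊆ w) (hu : u.card = F.card + a) (hw : w.card = F.card + a) (hua : (u ∩ I).card = a)
    (hwa : (w ∩ I).card = a) (hIv : I \ w ⊆ v) (hEu : E ⊆ u) (hEv : E ⊆ v) (hEI : Disjoint E I)
    (hE : E.card = t) (ht : (v ∩ u).card ≤ t) : u = w := by
  have hsub : E ⊆ v ∩ u := Finset.subset_inter hEv hEu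
  have hEq : E = v ∩ u := Finset.eq_of_subset_of_card_le hsub (by omega)
  have huw : u ∩ I ⊆ w ∩ I := by
    intro x hx
    rw [Finset.mem_inter] at hx ⊢
    refine ⟨?_, hx.2⟩
    by_contra hxw
    have : x ∈ E := by
      rw [hEq]
      exact Finset.mem_inter.2 ⟨hIv (Finset.mem_sdiff.2 ⟨hx.2, hxw⟩), hx.1⟩
    exact Finset.disjoint_left.1 hEI this hx.2
  rw [eq_union_inter_of_card hFI hFu (by omega), eq_union_inter_of_card hFI hFw (by omega),
    Finset.eq_of_subset_of_card_le huw (by omega)]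

lemma disjoint_Icc_one_Icc {a b c : ℕ} (h : a < b) :
    Disjoint (Finset.Icc 1 a) (Finset.Icc b c) := by
  rw [Finset.disjoint_left]
  intro x hx hx'
  rw [Finset.mem_Icc] at hx hx'
  omega

lemma le_or_le_of_mem_whiteSet₁ {n k t : ℕ} (htk : t < k)
    {v : KSubset n k} (hv : v ∈ whiteSet₁ n k t) {x : ℕ} (hx : x ∈ (v : Finset ℕ)) :
    x ≤ t ∨ n - 2 * k + 2 * t + 2 ≤ x := by
  have hc := hv.1
  have hcv := v.card_eq
  rw [eq_union_inter_of_card (I := Finset.Icc (n - 2 * k + 2 * t + 2) n)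
    (disjoint_Icc_one_Icc (by omega)) hv.2
    (by rw [hv.1, Nat.card_Icc, hcv]; omega)] at hx
  simp only [Finset.mem_union, Finset.mem_inter, Finset.mem_Icc] at hx
  omega

lemma succ_notMem_of_mem_whiteSet₁ {n k t : ℕ} (htk : t < k)
    {v : KSubset n k} (hv : v ∈ whiteSet₁ n k t) : t + 1 ∉ (v : Finset ℕ) := by
  intro h
  have := le_or_le_of_mem_whiteSet₁ htk hv h
  omega

lemma mem_whiteSet₂_iff {n k t : ℕ} (htk : t < k) {v : KSubset n k} :
    v ∈ whiteSet₂ n k t ↔ Finset.Icc 1 (t + 1) ⊆ (v : Finset ℕ) ∧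
      ((v : Finset ℕ) ∩ Finset.Icc (t + 2) (2 * k - t)).card = k - t - 1 := by
  have hcv := v.card_eq
  constructor
  · rintro ⟨h1, h2⟩
    refine ⟨h2, ?_⟩
    have : (v : Finset ℕ) ∩ Finset.Icc (t + 2) (2 * k - t) =
        (v : Finset ℕ) \ Finset.Icc 1 (t + 1) := by
      ext x
      by_cases hx : x ∈ (v : Finset ℕ)
      · have := Finset.mem_Icc.1 (h1 hx)
        simp only [Finset.mem_inter, Finset.mem_sdiff, Finset.mem_Icc, hx, true_and]
        omega
      · simp [hx]
    rw [this, Finset.card_sdiff_of_subset h2, hcv, Nat.card_Icc]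
    omega
  · rintro ⟨h1, h2⟩
    refine ⟨fun x hx => ?_, h1⟩
    rw [eq_union_inter_of_card (I := Finset.Icc (t + 2) (2 * k - t))
      (disjoint_Icc_one_Icc (by omega)) h1
      (by rw [h2, Nat.card_Icc, hcv]; omega)] at hx
    simp only [Finset.mem_union, Finset.mem_inter, Finset.mem_Icc] at hx ⊢
    omega

lemma ncard_eq_choose_of_mem_iff {n k a : ℕ} {W : Set (KSubset n k)} {F I : Finset ℕ}
    (hFI : Disjoint F I) (hF : F ⊆ Finset.Icc 1 n) (hI : I ⊆ Finset.Icc 1 n) (hk : F.card + a = k)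
    (hW : ∀ v : KSubset n k,
      v ∈ W ↔ F ⊆ (v : Finset ℕ) ∧ ((v : Finset ℕ) ∩ I).card = a) :
    W.ncard = I.card.choose a := by
  rw [← Finset.card_powersetCard, ← Set.ncard_coe_finset]
  refine Set.ncard_congr (fun v _ => (v : Finset ℕ) ∩ I) ?_ ?_ ?_
  · intro v hv
    exact Finset.mem_coe.2 (Finset.mem_powersetCard.2 ⟨Finset.inter_subset_right, ((hW v).1 hv).2⟩)
  · intro v v' hv hv' h
    obtain ⟨h1, h2⟩ := (hW v).1 hv
    obtain ⟨h1', h2'⟩ := (hW v').1 hv'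
    apply Subtype.ext
    have h : (v : Finset ℕ) ∩ I = (v' : Finset ℕ) ∩ I := h
    rw [eq_union_inter_of_card hFI h1 (by rw [h2, v.card_eq, hk]), h,
      ← eq_union_inter_of_card hFI h1' (by rw [h2', v'.card_eq, hk])]
  · intro C hC
    obtain ⟨hCI, hCc⟩ := Finset.mem_powersetCard.1 (Finset.mem_coe.1 hC)
    have hFC : Disjoint F C := Finset.disjoint_of_subset_right hCI hFI
    have hint : (F ∪ C) ∩ I = C := by
      rw [Finset.union_inter_distrib_right, Finset.disjoint_iff_inter_eq_empty.1 hFI,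
        Finset.empty_union, Finset.inter_eq_left.2 hCI]
    refine ⟨⟨F ∪ C, Finset.mem_powersetCard.2 ⟨Finset.union_subset hF (hCI.trans hI), ?_⟩⟩, ?_, hint⟩
    · rw [Finset.card_union_of_disjoint hFC, hCc, hk]
    · rw [hW]
      exact ⟨Finset.subset_union_left, by rw [hint, hCc]⟩

lemma ncard_leaderSet_add {n k t : ℕ} (htk : t < k) (hn : 3 * k - 2 * t + 1 ≤ n)
    (hkn : 2 * k ≤ n) :
    (leaderSet n k t).ncard + (2 * k - 2 * t).choose (k - t) = n.choose k := by
  obtain ⟨m, rfl⟩ : ∃ m, k = t + m + 1 := ⟨k - t - 1, by omega⟩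
  have h1 : (whiteSet₁ n (t + m + 1) t).ncard = (2 * m + 1).choose (m + 1) := by
    rw [ncard_eq_choose_of_mem_iff (a := m + 1) (F := Finset.Icc 1 t)
      (I := Finset.Icc (n - 2 * (t + m + 1) + 2 * t + 2) n) (disjoint_Icc_one_Icc (by omega))
      (Finset.Icc_subset_Icc_right (by omega)) (Finset.Icc_subset_Icc_left (by omega))
      (by rw [Nat.card_Icc]; omega)
      (fun v => by
        rw [and_comm, whiteSet₁, Set.mem_ofPred_eq, show t + m + 1 - t = m + 1 by omega])]
    rw [Nat.card_Icc]
    congr 1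
    omega
  have h2 : (whiteSet₂ n (t + m + 1) t).ncard = (2 * m + 1).choose m := by
    rw [ncard_eq_choose_of_mem_iff (a := m) (F := Finset.Icc 1 (t + 1))
      (I := Finset.Icc (t + 2) (2 * (t + m + 1) - t)) (disjoint_Icc_one_Icc (by omega))
      (Finset.Icc_subset_Icc_right (by omega)) (Finset.Icc_subset_Icc (by omega) (by omega))
      (by rw [Nat.card_Icc]; omega)
      (fun v => by
        rw [mem_whiteSet₂_iff (by omega), show t + m + 1 - t - 1 = m by omega])]
    rw [Nat.card_Icc]
    congr 1
    omega
  have hdisj : Disjoint (whiteSet₁ n (t + m + 1) t) (whiteSet₂ n (t + m + 1) t) :=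
    Set.disjoint_left.2 fun v hv hv' => succ_notMem_of_mem_whiteSet₁ htk hv
      (hv'.2 (Finset.mem_Icc.2 ⟨by omega, le_rfl⟩))
  have htot := Set.ncard_add_ncard_compl (whiteSet₁ n (t + m + 1) t ∪ whiteSet₂ n (t + m + 1) t)
  rw [Set.ncard_union_eq hdisj, h1, h2, Nat.card_eq_fintype_card, Fintype.card_coe,
    Finset.card_powersetCard, Nat.card_Icc, Nat.add_sub_cancel] at htot
  rw [leaderSet, show 2 * (t + m + 1) - 2 * t = 2 * m + 1 + 1 by omega,
    show t + m + 1 - t = m + 1 by omega, Nat.choose_succ_succ']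
  omega

/-! ### The leader set is a zero forcing set -/

/-- A vertex `w` of the first family is forced by `[t + 1] ∪ (T \ w)`. -/
lemma exists_forcing_whiteSet₁ {n k t : ℕ} {S : Finset ℕ} (ht : IsGreatest (S : Set ℕ) t)
    (htk : t + 2 ≤ k) (hn : 3 * k - 2 * t + 1 ≤ n) (hkn : 2 * k ≤ n) {w : KSubset n k}
    (hw : w ∈ whiteSet₁ n k t) :
    ∃ v ∈ leaderSet n k t, (genJohnson S n k).Adj v w ∧
      ∀ u, (genJohnson S n k).Adj v u → u ∉ leaderSet n k t → u = w := by
  set T := Finset.Icc (n - 2 * k + 2 * t + 2) n with hT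
  have hw1 : ((w : Finset ℕ) ∩ T).card = k - t := hw.1
  have hcT : T.card = 2 * (k - t) - 1 := by rw [hT, Nat.card_Icc]; omega
  have hcQ : (T \ (w : Finset ℕ)).card = k - t - 1 := by
    rw [Finset.card_sdiff, hw1]; omega
  have hdisj : Disjoint (Finset.Icc 1 (t + 1)) T := disjoint_Icc_one_Icc (by omega)
  have hdisj' : Disjoint (Finset.Icc 1 t) T := disjoint_Icc_one_Icc (by omega)
  have hcv : (Finset.Icc 1 (t + 1) ∪ (T \ (w : Finset ℕ))).card = k := by
    rw [Finset.card_union_of_disjoint (Finset.disjoint_of_subset_right Finset.sdiff_subset hdisj),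
      hcQ, Nat.card_Icc]
    omega
  let v : KSubset n k := ⟨_, Finset.mem_powersetCard.2 ⟨Finset.union_subset
    (Finset.Icc_subset_Icc_right (by omega))
    (Finset.sdiff_subset.trans (Finset.Icc_subset_Icc_left (by omega))), hcv⟩⟩
  have hv : (v : Finset ℕ) = Finset.Icc 1 (t + 1) ∪ (T \ (w : Finset ℕ)) := rfl
  have hvt : t + 1 ∈ (v : Finset ℕ) := Finset.mem_union_left _ (Finset.mem_Icc.2 ⟨by omega, le_rfl⟩)
  have hwt := succ_notMem_of_mem_whiteSet₁ (by omega) hw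
  have hinter : (v : Finset ℕ) ∩ (w : Finset ℕ) = Finset.Icc 1 t := by
    ext x
    simp only [hv, Finset.mem_inter, Finset.mem_union, Finset.mem_sdiff]
    constructor
    · rintro ⟨h | h, hxw⟩
      · rw [Finset.mem_Icc] at h ⊢
        have : x ≠ t + 1 := fun h => hwt (h ▸ hxw)
        omega
      · exact absurd hxw h.2
    · exact fun h => ⟨.inl (Finset.Icc_subset_Icc_right (by omega) h), hw.2 h⟩
  refine ⟨v, ?_, ⟨fun h => hwt (h ▸ hvt), ?_⟩, ?_⟩
  · rintro (h | h)
    · exact succ_notMem_of_mem_whiteSet₁ (by omega) h hvt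
    · -- The part of `T` inside `[2k - t]` has at most `k - t - 2` points.
      have hsub : T \ (w : Finset ℕ) ⊆ Finset.Icc (n - 2 * k + 2 * t + 2) (2 * k - t) := by
        intro x hx
        have h1 := Finset.mem_Icc.1 (h.1 (Finset.mem_union_right _ hx))
        have h2 := Finset.mem_Icc.1 (Finset.sdiff_subset hx)
        exact Finset.mem_Icc.2 ⟨h2.1, h1.2⟩
      have := Finset.card_le_card hsub
      rw [hcQ, Nat.card_Icc] at this
      omega
  · rw [hinter, Nat.card_Icc, Nat.add_sub_cancel]
    exact ht.1
  · intro u hvu hu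
    have hle : ((v : Finset ℕ) ∩ (u : Finset ℕ)).card ≤ t := ht.2 hvu.2
    rcases not_not.1 hu with hu | hu
    · apply Subtype.ext
      exact eq_of_card_inter_le (E := Finset.Icc 1 t) hdisj' hu.2 hw.2
        (by rw [u.card_eq, Nat.card_Icc, Nat.add_sub_cancel, Nat.add_sub_cancel' (by omega)])
        (by rw [w.card_eq, Nat.card_Icc, Nat.add_sub_cancel, Nat.add_sub_cancel' (by omega)])
        hu.1 hw1 Finset.subset_union_right hu.2
        ((Finset.Icc_subset_Icc_right (by omega)).trans Finset.subset_union_left) hdisj'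
        (by rw [Nat.card_Icc, Nat.add_sub_cancel]) hle
    · have := Finset.card_le_card (Finset.subset_inter Finset.subset_union_left hu.2 :
        Finset.Icc 1 (t + 1) ⊆ (v : Finset ℕ) ∩ (u : Finset ℕ))
      rw [Nat.card_Icc] at this
      omega

/-- Once the first family is black, a vertex `w` of the second one is forced by
`[t] ∪ ({t + 2, …, 2k - t} \ w)`. -/
lemma exists_forcing_whiteSet₂ {n k t : ℕ} {S : Finset ℕ} (ht : IsGreatest (S : Set ℕ) t)
    (htk : t < k) (hn : 2 * k ≤ n + t) {w : KSubset n k} (hw : w ∈ whiteSet₂ n k t) :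
    ∃ v ∉ whiteSet₂ n k t, (genJohnson S n k).Adj v w ∧
      ∀ u, (genJohnson S n k).Adj v u → u ∈ whiteSet₂ n k t → u = w := by
  set I := Finset.Icc (t + 2) (2 * k - t) with hI
  obtain ⟨hw1, hw2⟩ := (mem_whiteSet₂_iff htk).1 hw
  have hcQ : (I \ (w : Finset ℕ)).card = k - t := by
    rw [Finset.card_sdiff, hw2, hI, Nat.card_Icc]; omega
  have hdisj : Disjoint (Finset.Icc 1 (t + 1)) I := disjoint_Icc_one_Icc (by omega)
  have hdisj' : Disjoint (Finset.Icc 1 t) I := disjoint_Icc_one_Icc (by omega)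
  have hw1' : Finset.Icc 1 t ⊆ (w : Finset ℕ) :=
    (Finset.Icc_subset_Icc_right (by omega)).trans hw1
  obtain ⟨v, hv, hadj⟩ := exists_genJohnson_vertex (n := n) ht.1 htk (P := Finset.Icc 1 t)
    (Q := I \ (w : Finset ℕ)) (Finset.Icc_subset_Icc_right (by omega))
    (Finset.sdiff_subset.trans (Finset.Icc_subset_Icc (by omega) (by omega)))
    (Finset.disjoint_of_subset_right Finset.sdiff_subset hdisj')
    (by rw [Nat.card_Icc, Nat.add_sub_cancel]) hcQ
  refine ⟨v, fun h => ?_, (hadj w hw1' Finset.disjoint_sdiff).symm, fun u hvu hu => ?_⟩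
  · have : t + 1 ∈ (v : Finset ℕ) := h.2 (Finset.mem_Icc.2 ⟨by omega, le_rfl⟩)
    simp only [hv, hI, Finset.mem_union, Finset.mem_sdiff, Finset.mem_Icc] at this
    omega
  · obtain ⟨hu1, hu2⟩ := (mem_whiteSet₂_iff htk).1 hu
    apply Subtype.ext
    exact eq_of_card_inter_le (E := Finset.Icc 1 t) hdisj hu1 hw1
      (by rw [u.card_eq, Nat.card_Icc]; omega) (by rw [w.card_eq, Nat.card_Icc]; omega) hu2 hw2
      (by rw [hv]; exact Finset.subset_union_right)
      ((Finset.Icc_subset_Icc_right (by omega)).trans hu1)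
      (by rw [hv]; exact Finset.subset_union_left) hdisj'
      (by rw [Nat.card_Icc, Nat.add_sub_cancel]) (ht.2 hvu.2)

lemma isZeroForcingSet_leaderSet {n k t : ℕ} {S : Finset ℕ} (ht : IsGreatest (S : Set ℕ) t)
    (htk : t + 2 ≤ k) (hn : 3 * k - 2 * t + 1 ≤ n) (hkn : 2 * k ≤ n) :
    IsZeroForcingSet (genJohnson S n k) (leaderSet n k t) := by
  refine (reflTransGen_forceStep_union (Set.toFinite (whiteSet₁ n k t))
    fun w hw => exists_forcing_whiteSet₁ ht htk hn hkn hw).trans ?_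
  have huniv : leaderSet n k t ∪ whiteSet₁ n k t ∪ whiteSet₂ n k t = Set.univ := by
    rw [Set.union_assoc, leaderSet, Set.compl_union_self]
  rw [← huniv]
  refine reflTransGen_forceStep_union (Set.toFinite (whiteSet₂ n k t)) fun w hw => ?_
  have hmem (u) : u ∈ leaderSet n k t ∪ whiteSet₁ n k t ∨ u ∈ whiteSet₂ n k t := by
    rw [← Set.mem_union, huniv]
    exact Set.mem_univ u
  obtain ⟨v, hv, hvw, huniq⟩ := exists_forcing_whiteSet₂ ht (by omega) (by omega) hw
  exact ⟨v, (hmem v).resolve_right hv, hvw, fun u hvu hu => huniq u hvu ((hmem u).resolve_left hu)⟩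

/-! ### The leader set is connected -/

lemma mem_leaderSet_of_succ_mem {n k t : ℕ} (htk : t < k) (hn : 2 * k < n + t)
    {v : KSubset n k} (h1 : t + 1 ∈ (v : Finset ℕ)) (h2 : n ∈ (v : Finset ℕ)) :
    v ∈ leaderSet n k t := by
  rintro (h | h)
  · exact succ_notMem_of_mem_whiteSet₁ htk h h1
  · have := Finset.mem_Icc.1 (h.1 h2)
    omega

/-- Two vertices, one of which contains `t + 1` and `n`, have a common neighbour in the leader set
if they differ in at most two points. -/
lemma exists_common_leader_neighbor {n k t : ℕ} {S : Finset ℕ} (htS : t ∈ S) (htk : t + 2 ≤ k)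
    (hn : 3 * k - 2 * t + 1 ≤ n) {v v' : KSubset n k} (h1 : t + 1 ∈ (v' : Finset ℕ))
    (h2 : n ∈ (v' : Finset ℕ)) (hvv' : k ≤ ((v : Finset ℕ) ∩ (v' : Finset ℕ)).card + 2) :
    ∃ u ∈ leaderSet n k t, (genJohnson S n k).Adj v u ∧ (genJohnson S n k).Adj v' u := by
  obtain ⟨P, hP, hcP⟩ := Finset.exists_subset_card_eq
    (s := (v : Finset ℕ) ∩ (v' : Finset ℕ)) (n := t) (by omega)
  have hPv := hP.trans Finset.inter_subset_left
  have hPv' := hP.trans Finset.inter_subset_right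
  set O := Finset.Icc 1 n \ ((v : Finset ℕ) ∪ (v' : Finset ℕ)) with hO
  have hcO : 2 * (k - t) - 1 ≤ O.card := by
    have h := Finset.card_union_add_card_inter (v : Finset ℕ) (v' : Finset ℕ)
    rw [v.card_eq, v'.card_eq] at h
    rw [hO, Finset.card_sdiff_of_subset (Finset.union_subset v.subset_Icc v'.subset_Icc),
      Nat.card_Icc]
    omega
  have hOv : Disjoint (v : Finset ℕ) O :=
    Finset.disjoint_of_subset_left Finset.subset_union_left Finset.disjoint_sdiff
  have hOv' : Disjoint (v' : Finset ℕ) O :=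
    Finset.disjoint_of_subset_left Finset.subset_union_right Finset.disjoint_sdiff
  have key (Q : Finset ℕ) (hQ : Q ⊆ O) (hcQ : Q.card = k - t) :
      ∃ u : KSubset n k, (u : Finset ℕ) = P ∪ Q ∧ (genJohnson S n k).Adj v u ∧
        (genJohnson S n k).Adj v' u := by
    obtain ⟨u, hu, hadj⟩ := exists_genJohnson_vertex (n := n) htS (by omega : t < k)
      (hPv.trans v.subset_Icc) (hQ.trans Finset.sdiff_subset)
      (Finset.disjoint_of_subset_left hPv (Finset.disjoint_of_subset_right hQ hOv)) hcP hcQ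
    exact ⟨u, hu, hadj v hPv (Finset.disjoint_of_subset_right hQ hOv),
      hadj v' hPv' (Finset.disjoint_of_subset_right hQ hOv')⟩
  by_cases hex : ∃ o ∈ O, o ≤ t
  · -- Every white vertex contains `[t]`, so a neighbour missing `o` is black.
    obtain ⟨o, ho, hot⟩ := hex
    obtain ⟨Q, hQ, hcQ⟩ := Finset.exists_subset_card_eq (s := O.erase o) (n := k - t)
      (by rw [Finset.card_erase_of_mem ho]; omega)
    obtain ⟨u, hu, hvu, hv'u⟩ := key Q (hQ.trans (Finset.erase_subset _ _)) hcQ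
    have hou : o ∉ (u : Finset ℕ) := by
      rw [hu, Finset.mem_union, not_or]
      exact ⟨fun h => Finset.disjoint_left.1 hOv (hPv h) ho,
        fun h => (Finset.mem_erase.1 (hQ h)).1 rfl⟩
    have ho1 := (Finset.mem_Icc.1 (Finset.sdiff_subset ho)).1
    refine ⟨u, ?_, hvu, hv'u⟩
    rintro (h | h)
    · exact hou (h.2 (Finset.mem_Icc.2 ⟨ho1, hot⟩))
    · exact hou (h.2 (Finset.mem_Icc.2 ⟨ho1, by omega⟩))
  · -- Some `o ∈ O` lies outside `T`, because `n ∉ O`; a neighbour containing `o` is not in the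
    -- first family, and `P` has too few points for it to be in the second one.
    push Not at hex
    have hnO : n ∉ O := fun h => Finset.disjoint_left.1 hOv' h2 h
    have htO : t + 1 ∉ O := fun h => Finset.disjoint_left.1 hOv' h1 h
    obtain ⟨o, ho, hoT⟩ : ∃ o ∈ O, o ∉ Finset.Icc (n - 2 * k + 2 * t + 2) (n - 1) := by
      refine Finset.exists_mem_notMem_of_card_lt_card ?_
      rw [Nat.card_Icc]
      omega
    obtain ⟨Q, hoQ, hQ, hcQ⟩ := Finset.exists_subsuperset_card_eq (n := k - t)
      (Finset.singleton_subset_iff.2 ho) (by rw [Finset.card_singleton]; omega) (by omega)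
    obtain ⟨u, hu, hvu, hv'u⟩ := key Q hQ hcQ
    refine ⟨u, ?_, hvu, hv'u⟩
    rintro (h | h)
    · have hou : o ∈ (u : Finset ℕ) := by
        rw [hu]
        exact Finset.mem_union_right _ (Finset.singleton_subset_iff.1 hoQ)
      have h3 := le_or_le_of_mem_whiteSet₁ (by omega) h hou
      have h4 := hex o ho
      have h5 := (Finset.mem_Icc.1 (Finset.sdiff_subset ho)).2
      have h6 : o ≠ n := fun h => hnO (h ▸ ho)
      rw [Finset.mem_Icc] at hoT
      omega
    · have hsub : Finset.Icc 1 (t + 1) ⊆ P := by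
        intro x hx
        have hxu := h.2 hx
        rw [hu, Finset.mem_union] at hxu
        refine hxu.resolve_right fun hxQ => ?_
        have h3 := hex x (hQ hxQ)
        have h4 : x ≠ t + 1 := fun h => htO (h ▸ hQ hxQ)
        rw [Finset.mem_Icc] at hx
        omega
      have := Finset.card_le_card hsub
      rw [Nat.card_Icc] at this
      omega

/-- A vertex `v` different from a vertex `h` containing `t + 1` and `n` is at most two exchanges
away from a vertex which is closer to `h` and contains `t + 1` and `n`. -/
lemma exists_exchange {n k t : ℕ} {v h : KSubset n k} (h1 : t + 1 ∈ (h : Finset ℕ))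
    (h2 : n ∈ (h : Finset ℕ)) (hvh : v ≠ h) :
    ∃ v' : KSubset n k, t + 1 ∈ (v' : Finset ℕ) ∧ n ∈ (v' : Finset ℕ) ∧
      k ≤ ((v : Finset ℕ) ∩ (v' : Finset ℕ)).card + 2 ∧
      ((v' : Finset ℕ) \ (h : Finset ℕ)).card < ((v : Finset ℕ) \ (h : Finset ℕ)).card := by
  obtain ⟨v, hv⟩ := v
  obtain ⟨h, hh⟩ := h
  obtain ⟨hvn, hvk⟩ := Finset.mem_powersetCard.1 hv
  obtain ⟨hhn, hhk⟩ := Finset.mem_powersetCard.1 hh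
  simp only [ne_eq, Subtype.mk.injEq] at hvh h1 h2 ⊢
  have hDE : (v \ h).card = (h \ v).card := Finset.card_sdiff_comm (hvk.trans hhk.symm)
  have hpos : 0 < (h \ v).card := by
    rw [← hDE, Finset.card_pos, Finset.sdiff_nonempty]
    exact fun hs => hvh (Finset.eq_of_subset_of_card_le hs (by omega))
  have hpair : ((h \ v) ∩ {t + 1, n}).card ≤ 2 :=
    (Finset.card_le_card Finset.inter_subset_right).trans Finset.card_le_two
  obtain ⟨E, hE, hEh, hcE⟩ := Finset.exists_subsuperset_card_eq
    (Finset.inter_subset_left : (h \ v) ∩ {t + 1, n} ⊆ h \ v)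
    (le_max_left _ 1) (max_le (Finset.card_le_card Finset.inter_subset_left) hpos)
  obtain ⟨D, hD, hcD⟩ := Finset.exists_subset_card_eq (s := v \ h) (n := E.card)
    (by rw [hDE]; exact Finset.card_le_card hEh)
  have hE1 : 1 ≤ E.card := by rw [hcE]; exact le_max_right _ _
  have hE2 : E.card ≤ 2 := by rw [hcE]; exact max_le hpair (by omega)
  have hDv : D ⊆ v := hD.trans Finset.sdiff_subset
  have hcvD : (v \ D).card = k - E.card := by rw [Finset.card_sdiff_of_subset hDv, hvk, hcD]
  have hDk := Finset.card_le_card hDv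
  have hmem (x) (hxh : x ∈ h) (hx : x = t + 1 ∨ x = n) : x ∈ (v \ D) ∪ E := by
    by_cases hxv : x ∈ v
    · exact Finset.mem_union_left _
        (Finset.mem_sdiff.2 ⟨hxv, fun hxD => (Finset.mem_sdiff.1 (hD hxD)).2 hxh⟩)
    · exact Finset.mem_union_right _
        (hE (Finset.mem_inter.2 ⟨Finset.mem_sdiff.2 ⟨hxh, hxv⟩, by simpa using hx⟩))
  refine ⟨⟨(v \ D) ∪ E, Finset.mem_powersetCard.2 ⟨Finset.union_subset
    (Finset.sdiff_subset.trans hvn) (hEh.trans (Finset.sdiff_subset.trans hhn)), ?_⟩⟩,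
    hmem _ h1 (.inl rfl), hmem _ h2 (.inr rfl), ?_, ?_⟩
  · rw [Finset.card_union_of_disjoint, hcvD]
    · omega
    · exact Finset.disjoint_of_subset_left Finset.sdiff_subset
        (Finset.disjoint_of_subset_right hEh Finset.disjoint_sdiff)
  · have := Finset.card_le_card
      (Finset.subset_inter Finset.sdiff_subset Finset.subset_union_left : v \ D ⊆ v ∩ (v \ D ∪ E))
    simp only
    omega
  · have hsub : ((v \ D) ∪ E) \ h ⊆ (v \ h) \ D := by
      intro x hx
      simp only [Finset.mem_sdiff, Finset.mem_union] at hx ⊢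
      obtain ⟨hx | hx, hxh⟩ := hx
      · exact ⟨⟨hx.1, hxh⟩, hx.2⟩
      · exact absurd (Finset.sdiff_subset (hEh hx)) hxh
    have := Finset.card_le_card hsub
    rw [Finset.card_sdiff_of_subset hD] at this
    simp only
    omega

lemma connected_induce_leaderSet {n k t : ℕ} {S : Finset ℕ} (htS : t ∈ S) (htk : t + 2 ≤ k)
    (hn : 3 * k - 2 * t + 1 ≤ n) : ((genJohnson S n k).induce (leaderSet n k t)).Connected := by
  obtain ⟨h, hsub, hhn, hhk⟩ := Finset.exists_subsuperset_card_eq (n := k)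
    (show {t + 1, n} ⊆ Finset.Icc 1 n by
      intro x hx
      rw [Finset.mem_insert, Finset.mem_singleton] at hx
      rw [Finset.mem_Icc]
      omega)
    (Finset.card_le_two.trans (by omega)) (by rw [Nat.card_Icc]; omega)
  let h₀ : KSubset n k := ⟨h, Finset.mem_powersetCard.2 ⟨hhn, hhk⟩⟩
  have h1 : t + 1 ∈ (h₀ : Finset ℕ) := hsub (by simp)
  have h2 : n ∈ (h₀ : Finset ℕ) := hsub (by simp)
  have hleader (v : KSubset n k) (h1 : t + 1 ∈ (v : Finset ℕ)) (h2 : n ∈ (v : Finset ℕ)) :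
      v ∈ leaderSet n k t := mem_leaderSet_of_succ_mem (by omega) (by omega) h1 h2
  have hreach (d : ℕ) : ∀ v : leaderSet n k t,
      ((v : KSubset n k) \ (h₀ : Finset ℕ) : Finset ℕ).card = d →
      ((genJohnson S n k).induce (leaderSet n k t)).Reachable v ⟨h₀, hleader h₀ h1 h2⟩ := by
    induction d using Nat.strong_induction_on with
    | _ d ih =>
      rintro ⟨v, hv⟩ rfl
      by_cases hvh : v = h₀
      · subst hvh
        exact .refl _
      · obtain ⟨v', h1', h2', hvv', hlt⟩ := exists_exchange h1 h2 hvh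
        obtain ⟨u, hu, hvu, hv'u⟩ := exists_common_leader_neighbor htS htk hn h1' h2' hvv'
        have e1 : ((genJohnson S n k).induce (leaderSet n k t)).Adj ⟨v, hv⟩ ⟨u, hu⟩ := hvu
        have e2 : ((genJohnson S n k).induce (leaderSet n k t)).Adj ⟨u, hu⟩
            ⟨v', hleader v' h1' h2'⟩ := hv'u.symm
        exact e1.reachable.trans (e2.reachable.trans (ih _ hlt _ rfl))
  rw [SimpleGraph.connected_iff_exists_forall_reachable]
  exact ⟨⟨h₀, hleader h₀ h1 h2⟩, fun v => (hreach _ v rfl).symm⟩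

/-! ### The zero forcing numbers -/

theorem mainTheorem4 (n k t : ℕ) (S : Finset ℕ)
    (hS : S ⊆ Finset.range (k - 1)) (ht : IsGreatest (S : Set ℕ) t)
    (hn : max (3 * k - 2 * t + 1) (2 * k + 1) ≤ n) :
    -- the explicit witness and its exact size
    (IsConnectedZeroForcingSet (genJohnson S n k) (leaderSet n k t) ∧
      (leaderSet n k t).ncard + (2 * k - 2 * t).choose (k - t) = n.choose k) ∧
    -- the chain of inequalities
    (zeroForcingNumber (genJohnson S n k) ≤ totalZeroForcingNumber (genJohnson S n k) ∧
      totalZeroForcingNumber (genJohnson S n k) ≤ connectedZeroForcingNumber (genJohnson S n k) ∧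
      connectedZeroForcingNumber (genJohnson S n k) ≤
        ((n.choose k - (2 * k - 2 * t).choose (k - t) : ℕ) : ℕ∞)) ∧
    -- equality throughout for `S = {0, …, t}`
    (S = Finset.range (t + 1) →
      zeroForcingNumber (genJohnson S n k) =
          ((n.choose k - (2 * k - 2 * t).choose (k - t) : ℕ) : ℕ∞) ∧
        totalZeroForcingNumber (genJohnson S n k) =
          ((n.choose k - (2 * k - 2 * t).choose (k - t) : ℕ) : ℕ∞) ∧
        connectedZeroForcingNumber (genJohnson S n k) =
          ((n.choose k - (2 * k - 2 * t).choose (k - t) : ℕ) : ℕ∞)) := by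
  have htS : t ∈ S := ht.1
  have htk : t + 2 ≤ k := by
    have := Finset.mem_range.1 (hS htS)
    omega
  have hn1 : 3 * k - 2 * t + 1 ≤ n := (le_max_left _ _).trans hn
  have hn2 : 2 * k + 1 ≤ n := (le_max_right _ _).trans hn
  have hconn : IsConnectedZeroForcingSet (genJohnson S n k) (leaderSet n k t) :=
    ⟨isZeroForcingSet_leaderSet ht htk hn1 (by omega), connected_induce_leaderSet htS htk hn1⟩
  have hcard := ncard_leaderSet_add (t := t) (k := k) (by omega) hn1 (by omega)
  have hZt := zeroForcingNumber_le_totalZeroForcingNumber (genJohnson S n k)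
  have hZc := totalZeroForcingNumber_le_connectedZeroForcingNumber
    (exists_two_neighbors (n := n) htS (by omega : t < k) (by omega))
  have hup : connectedZeroForcingNumber (genJohnson S n k) ≤
      ((n.choose k - (2 * k - 2 * t).choose (k - t) : ℕ) : ℕ∞) := by
    refine (iInf₂_le _ hconn).trans ?_
    rw [← (Set.toFinite (leaderSet n k t)).cast_ncard_eq, ← hcard, Nat.add_sub_cancel]
  refine ⟨⟨hconn, hcard⟩, ⟨hZt, hZc, hup⟩, ?_⟩
  rintro rfl
  have hlow : ((n.choose k - (2 * k - 2 * t).choose (k - t) : ℕ) : ℕ∞) ≤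
      zeroForcingNumber (genJohnson (Finset.range (t + 1)) n k) := by
    refine le_iInf₂ fun B hB => ?_
    rw [← (Set.toFinite B).cast_ncard_eq, Nat.cast_le, Nat.sub_le_iff_le_add]
    exact choose_le_ncard_add_of_isZeroForcingSet (by omega) hB
  exact ⟨le_antisymm (hZt.trans (hZc.trans hup)) hlow,
    le_antisymm (hZc.trans hup) (hlow.trans hZt),
    le_antisymm hup (hlow.trans (hZt.trans hZc))⟩
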